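/- Write $\mathcal P_n=\{i^{\ell}P_1\otimes\cdots\otimes P_n : \ell\in\{0,1,2,3\},\ P_j\in\{I,X,Y,Z\}\}$ for the $n$-qubit Pauli group. The weight of $P=i^\ell P_1\otimes\cdots\otimes P_n$ is the number of $j$ with $P_j\ne I$ (the qubits on which $P$ acts). A stabilizer group is an abelian subgroup of $\mathcal P_n$ not containing $-I$. **Setting.** Let $N\subseteq\mathbb N$ be a set of system sizes and, for each $n\in N$, let $S_n\subseteq\mathcal P_n$ be a finite non-empty set generating a stabilizer group, where each element of $S_n$ is either a tensor product of only $X$'s and $I$'s or a tensor product of only $Z$'s and $I$'s. Assume that the family is LDPC: there is a constant $w$ such that for all $n\in N$ every $P\in S_n$ has weight at most $w$ and every qubit is acted on by at most $w$ elements of $S_n$, and $|S_n|=\Theta(n)$ as $n\to\infty$ in $N$. The associated CSS Hamiltonian and its $D$-rotated version are $$H_{S_n}=\frac1{|S_n|}\sum_{P\in S_n}\frac{I-P}{2},\qquad \tilde H_{S_n}=(D^\dagger)^{\otimes n}\,H_{S_n}\,D^{\otimes n},\qquad D=e^{-i\frac{\pi}{8}Y}.$$ **Definitions.** A pure $n$-qubit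 state $|\varphi\rangle$ (a unit vector) is a stabilizer state if exactly $2^n$ elements $P\in\mathcal P_n$ satisfy $P|\varphi\rangle=|\varphi\rangle$; a mixed state is a stabilizer state if it is a convex combination $\sum_j p_j|\varphi_j\rangle\langle\varphi_j|$ of pure ones. The energy of a state $\psi$ under $H$ is $\mathrm{Tr}[\psi H]$, and $E_0(H)$ is the minimum energy over all mixed states. A family $\{H^{(n)}\}_{n\in N}$ is a family of local Hamiltonians if there are a constant $k$ and numbers $m(n)\ge 1$ with $m(n)=\mathrm{poly}(n)$ such that for each $n\in N$, $H^{(n)}=\frac1{m(n)}\sum_{i=1}^{m(n)}H_i$ with each $H_i$ Hermitian, of spectral norm at most $1$, and acting non-trivially on at most $k$ qubits. Such a family is $\epsilon$-NLCS if for all sufficiently large $n\in N$ there is no $n$-qubit stabilizer state $\psi$ (pure or mixed) with $\mathrm{Tr}[\psi H^{(n)}]<E_0(H^{(n)})+\epsilon$; it is NLCS if it is $\epsilon$-NLCS for some constant $\epsilon>0$. **Theorem.** Let $\alpha>0$ be a constant such that for every $n\in N$ at least $\alpha|S_n|$ elements of $S_n$ have odd weight. Then $\{\tilde H_{S_n}\}_{n\in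 N}$ is a family of NLCS local Hamiltonians. More precisely, it is $\epsilon$-NLCS with $\epsilon=\alpha\sin^2(\pi/8)$, and for every $n\in N$ every (pure or mixed) $n$-qubit stabilizer state $\psi$ satisfies $$\mathrm{Tr}[\psi\,\tilde H_{S_n}]\ \ge\ \alpha\sin^2(\pi/8).$$ -/

import Mathlib

open scoped ComplexOrder

noncomputable section

namespace CSSNLCS

/-! Basis states of `n` qubits are bit strings `Fin n → Fin 2`; operators on `(ℂ²)^{⊗ n}` are
matrices indexed by bit strings. -/

/-- Computational-basis labels of `n` qubits. -/
abbrev Bits (n : ℕ) : Type := Fin n → Fin 2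

/-- Operators on the space of `n` qubits. -/
abbrev Op (n : ℕ) : Type := Matrix (Bits n) (Bits n) ℂ

/-- The tensor product `f 0 ⊗ ⋯ ⊗ f (n-1)` of single-qubit operators. -/
def tensor {n : ℕ} (f : Fin n → Matrix (Fin 2) (Fin 2) ℂ) : Op n :=
  Matrix.of fun x y => ∏ i, f i (x i) (y i)

/-! ### The Pauli group -/

/-- The four letters labelling the single-qubit Pauli matrices. -/
inductive Letter : Type
  | I
  | X
  | Y
  | Z
  deriving DecidableEq

/-- The single-qubit Pauli matrix of a letter. -/
def Letter.toMatrix : Letter → Matrix (Fin 2) (Fin 2) ℂ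
  | .I => 1
  | .X => !![0, 1; 1, 0]
  | .Y => !![0, -Complex.I; Complex.I, 0]
  | .Z => !![1, 0; 0, -1]

/-- The data `(ℓ; P₁, …, Pₙ)` of an element `i^ℓ P₁ ⊗ ⋯ ⊗ Pₙ` of the `n`-qubit Pauli group. -/
@[ext]
structure PauliElement (n : ℕ) : Type where
  phase : Fin 4
  letter : Fin n → Letter
  deriving DecidableEq

namespace PauliElement

variable {n : ℕ}

/-- The operator `i^ℓ P₁ ⊗ ⋯ ⊗ Pₙ`. -/
def toOp (P : PauliElement n) : Op n :=
  Complex.I ^ (P.phase : ℕ) • tensor fun i => (P.letter i).toMatrix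

/-- The qubits on which `P` acts non-trivially. -/
def support (P : PauliElement n) : Finset (Fin n) :=
  Finset.univ.filter fun i => P.letter i ≠ Letter.I

/-- The weight: the number of qubits on which `P` acts non-trivially. -/
def weight (P : PauliElement n) : ℕ := P.support.card

/-- `P` is a tensor product of only `X` and the identity. -/
def IsXType (P : PauliElement n) : Prop :=
  P.phase = 0 ∧ ∀ i, P.letter i = Letter.I ∨ P.letter i = Letter.X

/-- `P` is a tensor product of only `Z` and the identity. -/
def IsZType (P : PauliElement n) : Prop :=
  P.phase = 0 ∧ ∀ i, P.letter i = Letter.I ∨ P.letter i = Letter.Z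

/-- `Π_P = (1 - P) / 2`. -/
def proj (P : PauliElement n) : Op n := (1 / 2 : ℂ) • (1 - P.toOp)

end PauliElement

/-- The `n`-qubit Pauli group, as a set of operators. -/
def pauliGroup (n : ℕ) : Set (Op n) := Set.range PauliElement.toOp

/-! ### States and energies -/

/-- Mixed states (density operators) of `n` qubits. -/
def IsState {n : ℕ} (ρ : Op n) : Prop := ρ.PosSemidef ∧ ρ.trace = 1

/-- The operators of the Pauli group that stabilize the vector `φ`. -/
def stab {n : ℕ} (φ : Bits n → ℂ) : Set (Op n) :=
  {P | P ∈ pauliGroup n ∧ P.mulVec φ = φ}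

/-- Pure stabilizer states: unit vectors stabilized by exactly `2 ^ n` Pauli operators. -/
def IsPureStabilizerState {n : ℕ} (φ : Bits n → ℂ) : Prop :=
  star φ ⬝ᵥ φ = 1 ∧ (stab φ).ncard = 2 ^ n

/-- Mixed stabilizer states: convex combinations `∑ⱼ pⱼ |φⱼ⟩⟨φⱼ|` of pure stabilizer states. -/
def IsStabilizerState {n : ℕ} (ψ : Op n) : Prop :=
  ψ ∈ convexHull ℝ {ρ : Op n | ∃ φ, IsPureStabilizerState φ ∧ ρ = Matrix.vecMulVec φ (star φ)}

/-- The energy `Tr[ρ H]`, a real number for a state `ρ` and a Hermitian `H`. -/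
def energy {n : ℕ} (H ρ : Op n) : ℝ := (ρ * H).trace.re

/-- The ground-state energy: the minimum of `Tr[ρ H]` over all `n`-qubit mixed states `ρ`. -/
def groundEnergy {n : ℕ} (H : Op n) : ℝ := sInf (energy H '' {ρ | IsState ρ})

/-- `ψ` is an `ε`-low-energy state of `H`. -/
def IsLowEnergy {n : ℕ} (ε : ℝ) (H ψ : Op n) : Prop := energy H ψ < groundEnergy H + ε

/-! ### Local Hamiltonians -/

/-- `M` acts non-trivially only on the qubits of `A`: it is `h ⊗ 1` with `h` acting on `A`. -/
def ActsOn {n : ℕ} (A : Finset (Fin n)) (M : Op n) : Prop :=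
  ∃ h : Matrix (A → Fin 2) (A → Fin 2) ℂ, ∀ x y : Bits n,
    M x y = if ∀ i, i ∉ A → x i = y i then h (fun i => x i) (fun i => y i) else 0

/-- `H = (1/m) ∑ᵢ Hᵢ` with `m ≥ 1` Hermitian terms of spectral norm at most `1`, each acting
non-trivially on at most `k` qubits. -/
def IsLocalHamiltonian {n : ℕ} (k m : ℕ) (H : Op n) : Prop :=
  0 < m ∧ ∃ h : Fin m → Op n, H = (1 / (m : ℂ)) • ∑ i, h i ∧
    ∀ i, (h i).IsHermitian ∧ ‖Matrix.toEuclideanCLM (𝕜 := ℂ) (h i)‖ ≤ 1 ∧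
      ∃ A : Finset (Fin n), A.card ≤ k ∧ ActsOn A (h i)

/-- A family of local Hamiltonians, with one member for every system size `n ∈ N`: the locality
is bounded by a constant and the number of terms is polynomial in `n`. Values of `H` at sizes
outside `N` are irrelevant. -/
def IsLocalFamily (N : Set ℕ) (H : ∀ n : ℕ, Op n) : Prop :=
  ∃ (k : ℕ) (m : ℕ → ℕ),
    (∃ d : ℕ, (fun n => (m n : ℝ)) =O[Filter.atTop ⊓ Filter.principal N]
      fun n => (n : ℝ) ^ d) ∧
    ∀ n ∈ N, IsLocalHamiltonian k (m n) (H n)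

/-- The family of local Hamiltonians `H` is `ε`-NLCS: for all sufficiently large system sizes
there is no `ε`-low-energy stabilizer state. -/
def IsNLCSWith (ε : ℝ) (N : Set ℕ) (H : ∀ n : ℕ, Op n) : Prop :=
  IsLocalFamily N H ∧
    ∃ n₀ : ℕ, ∀ n ∈ N, n₀ ≤ n → ¬ ∃ ψ : Op n, IsStabilizerState ψ ∧ IsLowEnergy ε (H n) ψ

/-- The family is NLCS: it is `ε`-NLCS for some constant `ε > 0`. -/
def IsNLCS (N : Set ℕ) (H : ∀ n : ℕ, Op n) : Prop := ∃ ε : ℝ, 0 < ε ∧ IsNLCSWith ε N H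

/-! ### CSS codes and their Hamiltonians -/

/-- A stabilizer group: an abelian subgroup of the Pauli group not containing `-1`. -/
def IsStabilizerGroup {n : ℕ} (G : Subgroup (Op n)ˣ) : Prop :=
  (∀ g ∈ G, (g : Op n) ∈ pauliGroup n) ∧ (∀ g ∈ G, ∀ h ∈ G, g * h = h * g) ∧ (-1 : (Op n)ˣ) ∉ G

/-- The group `⟨S⟩` of operators generated by a set of Pauli elements. -/
def generated {n : ℕ} (S : Finset (PauliElement n)) : Subgroup (Op n)ˣ :=
  Subgroup.closure {u | ∃ P ∈ S, (u : Op n) = P.toOp}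

/-- `S` generates a CSS code. -/
def GeneratesCSS {n : ℕ} (S : Finset (PauliElement n)) : Prop :=
  IsStabilizerGroup (generated S) ∧ ∀ P ∈ S, P.IsXType ∨ P.IsZType

/-- The stabilizer Hamiltonian `H_S = (1/|S|) ∑_{P ∈ S} Π_P`. -/
def stabilizerHamiltonian {n : ℕ} (S : Finset (PauliElement n)) : Op n :=
  (1 / (S.card : ℂ)) • ∑ P ∈ S, P.proj

/-- `S` is a family of (non-empty) generating sets of CSS LDPC codes, one for every system size
`n ∈ N`: each generator acts on at most `w` qubits and each qubit is acted on by at most `w`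
generators, for a constant `w`, and `|S n| = Θ(n)`. -/
structure IsCSSLDPCFamily (N : Set ℕ) (S : ∀ n : ℕ, Finset (PauliElement n)) : Prop where
  nonempty : ∀ n ∈ N, (S n).Nonempty
  css : ∀ n ∈ N, GeneratesCSS (S n)
  sparse : ∃ w : ℕ, ∀ n ∈ N, (∀ P ∈ S n, P.weight ≤ w) ∧
    ∀ q : Fin n, ((S n).filter fun P => q ∈ P.support).card ≤ w
  card_theta : (fun n => ((S n).card : ℝ)) =Θ[Filter.atTop ⊓ Filter.principal N]
    fun n => (n : ℝ)

/-! ### The rotation -/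

/-- The single-qubit gate `D = exp(-i (π/8) Y)`. -/
def gateD : Matrix (Fin 2) (Fin 2) ℂ :=
  NormedSpace.exp ((-(Complex.I * ((Real.pi / 8 : ℝ) : ℂ))) • Letter.Y.toMatrix)

/-- The `D`-rotated version `(D†)^{⊗ n} H D^{⊗ n}` of `H`. -/
def rotated {n : ℕ} (H : Op n) : Op n :=
  (tensor fun _ => gateD.conjTranspose) * H * tensor fun _ => gateD

end CSSNLCS

end

/-!
Rotating by `D` turns a check `P` that is a product of `X`s (or of `Z`s) on `k` qubits into a
Clifford operator `C`: a tensor product of `k` (signed) Hadamard gates. So for a pure stabilizer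
state `φ` the expectation `⟨φ, C φ⟩` is an overlap of two stabilizer states. It is a real number,
and the energy of `φ` on the rotated check is `(1 - ⟨φ, C φ⟩) / 2`.

If `k` is odd, this overlap is at most `1 / √2` (`IsPureStabilizerState.overlap_le`):

* The projector onto `φ` is the average of the stabilizer of `φ`
  (`IsPureStabilizerState.exists_groupProj`). If `C` maps the stabilizer to itself, then `φ` is an
  eigenvector of `C` and the overlap is `±1`. But the projector has entries in `ℚ(i)`, while `C` is
  `√2 ^ (-k)` times an integral matrix, so the overlap lies in `√2 ^ k ℚ(i)`, which does not contain
  `±1` as `k` is odd.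
* Otherwise some Pauli operator `U` fixes `C φ` but not `φ`. Then `U φ = -φ`, and the overlap is
  zero, or `U φ` is orthogonal to `φ` (`IsPureStabilizerState.eigenvector_or_orthogonal`), and
  `2 ⟨φ, C φ⟩ = ⟨φ + U φ, C φ⟩ ≤ √2`.

As `(1 - 1 / √2) / 2 = sin² (π / 8)`, every odd-weight check contributes at least this energy. The
other checks contribute non-negative energy, and the bound passes to convex combinations
(`le_energy_of_isStabilizerState`). The ground-state energy is zero, since the code space of a
stabilizer group is non-trivial (`groundEnergy_nonpos` is the half that is needed), so no
stabilizer state has energy below `groundEnergy + α sin² (π / 8)`.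
-/

namespace CSSNLCS

open Matrix

/-! ### Tensor products -/

section Tensor

variable {n : ℕ}

lemma tensor_mul (f g : Fin n → Matrix (Fin 2) (Fin 2) ℂ) :
    tensor f * tensor g = tensor fun i => f i * g i := by
  ext x y
  simp only [tensor, Matrix.mul_apply, Matrix.of_apply]
  rw [Finset.prod_univ_sum, Fintype.piFinset_univ]
  simp only [Finset.prod_mul_distrib]

lemma tensor_one : tensor (fun _ : Fin n => (1 : Matrix (Fin 2) (Fin 2) ℂ)) = 1 := by
  ext x y
  simp only [tensor, Matrix.of_apply, Matrix.one_apply, Fintype.prod_ite_zero,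
    Finset.prod_const_one, funext_iff]

lemma tensor_smul (c : Fin n → ℂ) (f : Fin n → Matrix (Fin 2) (Fin 2) ℂ) :
    (tensor fun i => c i • f i) = (∏ i, c i) • tensor f := by
  ext x y
  simp [tensor, Finset.prod_mul_distrib]

lemma conjTranspose_tensor (f : Fin n → Matrix (Fin 2) (Fin 2) ℂ) :
    (tensor f)ᴴ = tensor fun i => (f i)ᴴ := by
  ext x y
  simp [tensor, Matrix.conjTranspose_apply]

lemma trace_tensor (f : Fin n → Matrix (Fin 2) (Fin 2) ℂ) :
    (tensor f).trace = ∏ i, (f i).trace := by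
  simp only [tensor, Matrix.trace, Matrix.diag_apply, Matrix.of_apply]
  rw [Finset.prod_univ_sum, Fintype.piFinset_univ]

/-- A tensor product acts non-trivially only where its factors are not the identity. -/
lemma actsOn_tensor (A : Finset (Fin n)) (f : Fin n → Matrix (Fin 2) (Fin 2) ℂ)
    (hf : ∀ i, i ∉ A → f i = 1) : ActsOn A (tensor f) := by
  refine ⟨Matrix.of fun x y => ∏ i : A, f i (x i) (y i), fun x y => ?_⟩
  simp only [tensor, Matrix.of_apply]
  rw [← Finset.prod_mul_prod_compl A, ← Finset.prod_coe_sort A]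
  have h : ∏ i ∈ Aᶜ, f i (x i) (y i) = if ∀ i, i ∉ A → x i = y i then 1 else 0 := by
    calc ∏ i ∈ Aᶜ, f i (x i) (y i) = ∏ i ∈ Aᶜ, if x i = y i then (1 : ℂ) else 0 :=
          Finset.prod_congr rfl fun i hi => by
            rw [hf i (Finset.mem_compl.1 hi), Matrix.one_apply]
      _ = _ := by rw [Finset.prod_ite_zero]; simp
  rw [h]
  simp

end Tensor

/-! ### The Pauli group -/

section Pauli

variable {n : ℕ}

instance : Fintype Letter := ⟨{.I, .X, .Y, .Z}, fun L => by cases L <;> simp⟩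

lemma Letter.conjTranspose_toMatrix (L : Letter) : L.toMatrixᴴ = L.toMatrix := by
  cases L <;> ext i j <;> fin_cases i <;> fin_cases j <;> simp [Letter.toMatrix]

lemma Letter.toMatrix_mul_self (L : Letter) : L.toMatrix * L.toMatrix = 1 := by
  cases L <;> ext i j <;> fin_cases i <;> fin_cases j <;> simp [Letter.toMatrix]

lemma Letter.trace_toMatrix {L : Letter} (h : L ≠ .I) : L.toMatrix.trace = 0 := by
  cases L <;> simp_all [Letter.toMatrix, Matrix.trace_fin_two]

lemma Letter.exists_mul (L M : Letter) :
    ∃ (s : ℕ) (K : Letter), L.toMatrix * M.toMatrix = Complex.I ^ s • K.toMatrix := by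
  have key : ∀ (s : ℕ) (K : Letter), L.toMatrix * M.toMatrix = Complex.I ^ s • K.toMatrix →
      ∃ (s : ℕ) (K : Letter), L.toMatrix * M.toMatrix = Complex.I ^ s • K.toMatrix :=
    fun s K h => ⟨s, K, h⟩
  cases L <;> cases M
  on_goal 1 => apply key 0 .I
  on_goal 2 => apply key 0 .X
  on_goal 3 => apply key 0 .Y
  on_goal 4 => apply key 0 .Z
  on_goal 5 => apply key 0 .X
  on_goal 6 => apply key 0 .I
  on_goal 7 => apply key 1 .Z
  on_goal 8 => apply key 3 .Y
  on_goal 9 => apply key 0 .Y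
  on_goal 10 => apply key 3 .Z
  on_goal 11 => apply key 0 .I
  on_goal 12 => apply key 1 .X
  on_goal 13 => apply key 0 .Z
  on_goal 14 => apply key 1 .Y
  on_goal 15 => apply key 3 .X
  on_goal 16 => apply key 0 .I
  all_goals
    ext i j; fin_cases i <;> fin_cases j <;> simp [Letter.toMatrix, Complex.I_pow_three]

lemma Letter.exists_mul_comm (L M : Letter) :
    ∃ s : ℕ, L.toMatrix * M.toMatrix = (-1 : ℂ) ^ s • (M.toMatrix * L.toMatrix) := by
  by_cases h : L = .I ∨ M = .I ∨ L = M
  · refine ⟨0, ?_⟩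
    rcases h with rfl | rfl | rfl <;> simp [Letter.toMatrix]
  · refine ⟨1, ?_⟩
    cases L <;> cases M <;> simp at h <;>
    · ext i j; fin_cases i <;> fin_cases j <;> simp [Letter.toMatrix]

/-- The tensor product of the Pauli matrices of a string of letters. -/
def pauliString (L : Fin n → Letter) : Op n := tensor fun i => (L i).toMatrix

lemma mem_pauliGroup_iff {A : Op n} :
    A ∈ pauliGroup n ↔ ∃ (s : ℕ) (L : Fin n → Letter), A = Complex.I ^ s • pauliString L := by
  constructor
  · rintro ⟨P, rfl⟩
    exact ⟨P.phase, P.letter, rfl⟩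
  · rintro ⟨s, L, rfl⟩
    refine ⟨⟨⟨s % 4, Nat.mod_lt _ (by norm_num)⟩, L⟩, ?_⟩
    simp only [PauliElement.toOp, pauliString]
    rw [← Complex.I_pow_eq_pow_mod]

lemma pauliString_mul_self (L : Fin n → Letter) : pauliString L * pauliString L = 1 := by
  simp [pauliString, tensor_mul, Letter.toMatrix_mul_self, tensor_one]

lemma conjTranspose_pauliString (L : Fin n → Letter) : (pauliString L)ᴴ = pauliString L := by
  simp [pauliString, conjTranspose_tensor, Letter.conjTranspose_toMatrix]

/-- A tensor product of Pauli matrices with phases is in the Pauli group. -/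
lemma tensor_mem_pauliGroup (f : Fin n → Matrix (Fin 2) (Fin 2) ℂ)
    (hf : ∀ i, ∃ (s : ℕ) (K : Letter), f i = Complex.I ^ s • K.toMatrix) :
    tensor f ∈ pauliGroup n := by
  choose s K h using hf
  refine mem_pauliGroup_iff.2 ⟨∑ i, s i, K, ?_⟩
  rw [pauliString, ← Finset.prod_pow_eq_pow_sum, ← tensor_smul]
  exact congrArg tensor (funext h)

lemma smul_I_pow_mem_pauliGroup {A : Op n} (hA : A ∈ pauliGroup n) (s : ℕ) :
    Complex.I ^ s • A ∈ pauliGroup n := by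
  obtain ⟨t, L, rfl⟩ := mem_pauliGroup_iff.1 hA
  exact mem_pauliGroup_iff.2 ⟨s + t, L, by rw [smul_smul, pow_add]⟩

lemma mul_mem_pauliGroup {A B : Op n} (hA : A ∈ pauliGroup n) (hB : B ∈ pauliGroup n) :
    A * B ∈ pauliGroup n := by
  obtain ⟨s, L, rfl⟩ := mem_pauliGroup_iff.1 hA
  obtain ⟨t, M, rfl⟩ := mem_pauliGroup_iff.1 hB
  rw [Matrix.smul_mul, Matrix.mul_smul]
  refine smul_I_pow_mem_pauliGroup (smul_I_pow_mem_pauliGroup ?_ t) s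
  rw [pauliString, pauliString, tensor_mul]
  exact tensor_mem_pauliGroup _ fun i => Letter.exists_mul _ _

lemma one_mem_pauliGroup : (1 : Op n) ∈ pauliGroup n := by
  rw [← tensor_one]
  exact tensor_mem_pauliGroup _ fun i => ⟨0, .I, by simp [Letter.toMatrix]⟩

/-- Two elements of the Pauli group either commute or anticommute. -/
lemma commute_or_anticommute {A B : Op n} (hA : A ∈ pauliGroup n) (hB : B ∈ pauliGroup n) :
    A * B = B * A ∨ A * B = -(B * A) := by
  obtain ⟨s, L, rfl⟩ := mem_pauliGroup_iff.1 hA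
  obtain ⟨t, M, rfl⟩ := mem_pauliGroup_iff.1 hB
  choose e he using fun i => Letter.exists_mul_comm (L i) (M i)
  have h : pauliString L * pauliString M =
      (-1 : ℂ) ^ (∑ i, e i) • (pauliString M * pauliString L) := by
    rw [pauliString, pauliString, tensor_mul, tensor_mul, ← Finset.prod_pow_eq_pow_sum,
      ← tensor_smul]
    simp [he]
  simp only [Matrix.smul_mul, Matrix.mul_smul, h]
  rcases neg_one_pow_eq_or ℂ (∑ i, e i) with h' | h' <;> rw [h']
  · left; rw [one_smul, smul_comm]
  · right; rw [neg_one_smul, smul_neg, smul_neg, smul_comm]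

/-- Elements of the Pauli group are unitary. -/
lemma conjTranspose_mul_self_of_mem_pauliGroup {A : Op n} (hA : A ∈ pauliGroup n) :
    Aᴴ * A = 1 := by
  obtain ⟨s, L, rfl⟩ := mem_pauliGroup_iff.1 hA
  rw [Matrix.conjTranspose_smul, conjTranspose_pauliString, Matrix.smul_mul, Matrix.mul_smul,
    pauliString_mul_self, smul_smul]
  simp [← mul_pow]

lemma mul_self_of_mem_pauliGroup {A : Op n} (hA : A ∈ pauliGroup n) :
    A * A = 1 ∨ A * A = -1 := by
  obtain ⟨s, L, rfl⟩ := mem_pauliGroup_iff.1 hA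
  rw [Matrix.smul_mul, Matrix.mul_smul, pauliString_mul_self, smul_smul, ← mul_pow, Complex.I_mul_I]
  rcases neg_one_pow_eq_or ℂ s with h | h <;> simp [h]

/-- An element of the Pauli group that squares to the identity and has non-zero trace is
`1` or `-1`. -/
lemma eq_one_or_neg_one_of_trace_ne_zero {A : Op n} (hA : A ∈ pauliGroup n) (h2 : A * A = 1)
    (htr : A.trace ≠ 0) : A = 1 ∨ A = -1 := by
  obtain ⟨s, L, rfl⟩ := mem_pauliGroup_iff.1 hA
  have hL : ∀ i, L i = .I := by
    by_contra! h
    obtain ⟨i, hi⟩ := h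
    apply htr
    rw [Matrix.trace_smul, pauliString, trace_tensor,
      Finset.prod_eq_zero (Finset.mem_univ i) (Letter.trace_toMatrix hi), smul_zero]
  have h1 : pauliString L = 1 := by
    simp [pauliString, hL, Letter.toMatrix, tensor_one]
  rw [h1] at h2 ⊢
  rw [Matrix.smul_mul, Matrix.mul_smul, mul_one, smul_smul] at h2
  have h3 := congrFun (congrFun h2 0) 0
  simp only [Matrix.smul_apply, Matrix.one_apply_eq, smul_eq_mul, mul_one] at h3
  rcases mul_self_eq_one_iff.1 h3 with h | h <;> simp [h]

lemma finite_pauliGroup : (pauliGroup n).Finite := by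
  have : Finite (PauliElement n) :=
    Finite.of_injective (fun P : PauliElement n => (P.phase, P.letter)) fun P Q h => by
      ext1 <;> simp_all
  exact Set.finite_range _

end Pauli

/-! ### The projector of a stabilizer group -/

section Projector

variable {n : ℕ}

/-- A finite set of operators forming a stabilizer group: it lies in the Pauli group, is closed
under multiplication, contains `1` and does not contain `-1`. (Closure under inverses and
commutativity follow.) -/
structure IsStabilizerFinset (F : Finset (Op n)) : Prop where
  pauli : ∀ A ∈ F, A ∈ pauliGroup n
  one_mem : 1 ∈ F
  mul_mem : ∀ A ∈ F, ∀ B ∈ F, A * B ∈ F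
  neg_one_notMem : -1 ∉ F

/-- The average `|F|⁻¹ ∑_{A ∈ F} A`, which for a stabilizer group is the projector onto its
code space. -/
noncomputable def groupProj (F : Finset (Op n)) : Op n := (F.card : ℂ)⁻¹ • ∑ A ∈ F, A

namespace IsStabilizerFinset

variable {F : Finset (Op n)} (hF : IsStabilizerFinset F)
include hF

lemma card_ne_zero : (F.card : ℂ) ≠ 0 :=
  Nat.cast_ne_zero.2 (Finset.card_ne_zero_of_mem hF.one_mem)

lemma mul_self {A : Op n} (hA : A ∈ F) : A * A = 1 :=
  (mul_self_of_mem_pauliGroup (hF.pauli A hA)).resolve_right fun h =>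
    hF.neg_one_notMem (h ▸ hF.mul_mem A hA A hA)

lemma isHermitian {A : Op n} (hA : A ∈ F) : A.IsHermitian :=
  left_inv_eq_right_inv (conjTranspose_mul_self_of_mem_pauliGroup (hF.pauli A hA)) (hF.mul_self hA)

lemma trace_eq_zero {A : Op n} (hA : A ∈ F) (h1 : A ≠ 1) : A.trace = 0 := by
  by_contra h
  rcases eq_one_or_neg_one_of_trace_ne_zero (hF.pauli A hA) (hF.mul_self hA) h with h | h
  · exact h1 h
  · exact hF.neg_one_notMem (h ▸ hA)

lemma mul_groupProj {A : Op n} (hA : A ∈ F) : A * groupProj F = groupProj F := by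
  rw [groupProj, Matrix.mul_smul, Finset.mul_sum]
  congr 1
  refine Finset.sum_nbij' (fun B => A * B) (fun B => A * B) (fun B hB => hF.mul_mem A hA B hB)
    (fun B hB => hF.mul_mem A hA B hB) ?_ ?_ (fun _ _ => rfl) <;>
  · intro B _
    simp only [← Matrix.mul_assoc, hF.mul_self hA, Matrix.one_mul]

lemma groupProj_mul_self : groupProj F * groupProj F = groupProj F := by
  nth_rewrite 1 [groupProj]
  rw [Matrix.smul_mul, Finset.sum_mul, Finset.sum_congr rfl fun A hA => hF.mul_groupProj hA,
    Finset.sum_const, ← Nat.cast_smul_eq_nsmul ℂ, smul_smul, inv_mul_cancel₀ hF.card_ne_zero,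
    one_smul]

lemma isHermitian_groupProj : (groupProj F).IsHermitian := by
  rw [groupProj, Matrix.IsHermitian, Matrix.conjTranspose_smul, Matrix.conjTranspose_sum,
    Finset.sum_congr rfl fun A hA => hF.isHermitian hA]
  simp

lemma trace_groupProj : (groupProj F).trace = (F.card : ℂ)⁻¹ * 2 ^ n := by
  rw [groupProj, Matrix.trace_smul, Matrix.trace_sum,
    Finset.sum_eq_single_of_mem 1 hF.one_mem fun A hA h => hF.trace_eq_zero hA h]
  simp

end IsStabilizerFinset

/-- A Hermitian idempotent is positive semidefinite. -/
lemma posSemidef_of_idempotent {K : Op n} (h : K.IsHermitian) (h2 : K * K = K) :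
    K.PosSemidef := by
  have := Matrix.posSemidef_conjTranspose_mul_self K
  rwa [h.eq, h2] at this

/-- A Hermitian idempotent with zero trace vanishes. -/
lemma eq_zero_of_idempotent {K : Op n} (h : K.IsHermitian) (h2 : K * K = K) (ht : K.trace = 0) :
    K = 0 := by
  rw [← Matrix.trace_conjTranspose_mul_self_eq_zero_iff, h.eq, h2, ht]

end Projector

/-! ### Pure stabilizer states -/

section PureState

variable {n : ℕ}

/-- The stabilizer of a pure stabilizer state is a stabilizer group of order `2 ^ n` whose projector
is the rank-one projector onto the state: the difference of the two is an idempotent of trace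
zero. -/
lemma IsPureStabilizerState.exists_groupProj {φ : Bits n → ℂ} (hφ : IsPureStabilizerState φ) :
    ∃ F : Finset (Op n), IsStabilizerFinset F ∧ (∀ A, A ∈ F ↔ A ∈ stab φ) ∧
      groupProj F = vecMulVec φ (star φ) := by
  obtain ⟨hnorm, hcard⟩ := hφ
  have hfin : (stab φ).Finite := finite_pauliGroup.subset fun A hA => hA.1
  have hmem : ∀ A, A ∈ hfin.toFinset ↔ A ∈ stab φ := fun A => hfin.mem_toFinset
  have hF : IsStabilizerFinset hfin.toFinset := by
    refine ⟨fun A hA => ((hmem A).1 hA).1, (hmem _).2 ⟨one_mem_pauliGroup, one_mulVec _⟩,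
      fun A hA B hB => ?_, fun h => ?_⟩
    · rw [hmem] at hA hB ⊢
      exact ⟨mul_mem_pauliGroup hA.1 hB.1, by rw [← mulVec_mulVec, hB.2, hA.2]⟩
    · have h0 := ((hmem _).1 h).2
      rw [neg_mulVec, one_mulVec, neg_eq_self] at h0
      simp [h0] at hnorm
  refine ⟨hfin.toFinset, hF, hmem, ?_⟩
  set Q := groupProj hfin.toFinset with hQ
  have hc : hfin.toFinset.card = 2 ^ n := by rw [← hcard, Set.ncard_eq_toFinset_card _ hfin]
  have hQφ : Q *ᵥ φ = φ := by
    rw [hQ, groupProj, smul_mulVec, Matrix.sum_mulVec,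
      Finset.sum_congr rfl fun A hA => ((hmem A).1 hA).2, Finset.sum_const,
      ← Nat.cast_smul_eq_nsmul ℂ, smul_smul, inv_mul_cancel₀ hF.card_ne_zero, one_smul]
  have hQH : Qᴴ = Q := hF.isHermitian_groupProj
  have hφQ : star φ ᵥ* Q = star φ := by
    conv_lhs => rw [← hQH]
    rw [← star_mulVec, hQφ]
  have hQQ : Q * Q = Q := hF.groupProj_mul_self
  rw [← sub_eq_zero]
  apply eq_zero_of_idempotent
  · rw [Matrix.IsHermitian, Matrix.conjTranspose_sub, hQH, conjTranspose_vecMulVec, star_star]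
  · rw [Matrix.sub_mul, Matrix.mul_sub, Matrix.mul_sub, hQQ, mul_vecMulVec, vecMulVec_mul,
      hQφ, hφQ, vecMulVec_mul_vecMulVec, hnorm]
    simp
  · rw [Matrix.trace_sub, hQ, hF.trace_groupProj, hc, trace_vecMulVec, dotProduct_comm, hnorm]
    simp

end PureState

/-! ### The rotation -/

section Rotation

variable {n : ℕ}

/-- Diagonalization of `Y` shows that `exp (-i θ Y)` is the real rotation by the angle `θ`. -/
lemma exp_neg_I_mul_smul_Y (θ : ℝ) :
    NormedSpace.exp ((-(Complex.I * (θ : ℂ))) • Letter.Y.toMatrix) =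
      !![(Real.cos θ : ℂ), -(Real.sin θ : ℂ); (Real.sin θ : ℂ), (Real.cos θ : ℂ)] := by
  -- The columns of `U` are eigenvectors of `Y`.
  set U : Matrix (Fin 2) (Fin 2) ℂ := !![1, 1; Complex.I, -Complex.I] with hU
  have hunit : IsUnit U := by
    have hdet : U.det = -2 * Complex.I := by
      rw [hU, Matrix.det_fin_two_of]; ring
    rw [Matrix.isUnit_iff_isUnit_det, hdet]
    simp
  have hinv : U⁻¹ = !![1 / 2, -Complex.I / 2; 1 / 2, Complex.I / 2] := by
    apply Matrix.inv_eq_right_inv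
    rw [hU, Matrix.mul_fin_two, Matrix.one_fin_two]
    ext i j
    fin_cases i <;> fin_cases j <;> simp <;> ring_nf <;> simp
  have hd : ∀ a b : ℂ, U * Matrix.diagonal ![a, b] * U⁻¹ =
      !![(a + b) / 2, -Complex.I * (a - b) / 2; Complex.I * (a - b) / 2, (a + b) / 2] := by
    intro a b
    have h : Matrix.diagonal ![a, b] = !![a, 0; 0, b] := by
      ext i j; fin_cases i <;> fin_cases j <;> simp
    rw [hinv, hU, h, Matrix.mul_fin_two, Matrix.mul_fin_two]
    congr 1
    have hI := Complex.I_mul_I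
    ext i j
    fin_cases i <;> fin_cases j <;> simp
    · ring
    · ring
    · ring
    · linear_combination (-(a + b) / 2) * hI
  have hdiag : (-(Complex.I * (θ : ℂ))) • Letter.Y.toMatrix =
      U * Matrix.diagonal ![-(θ : ℂ) * Complex.I, (θ : ℂ) * Complex.I] * U⁻¹ := by
    rw [hd]
    ext i j
    fin_cases i <;> fin_cases j <;> simp [Letter.toMatrix] <;> ring
  have hexp : NormedSpace.exp ![-(θ : ℂ) * Complex.I, (θ : ℂ) * Complex.I] =
      ![(Real.cos θ : ℂ) - (Real.sin θ : ℂ) * Complex.I,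
        (Real.cos θ : ℂ) + (Real.sin θ : ℂ) * Complex.I] := by
    ext i
    rw [Pi.coe_exp]
    simp only [← Complex.exp_eq_exp_ℂ]
    fin_cases i
    · simp [Complex.exp_mul_I, -neg_mul, sub_eq_add_neg]
      ring
    · simp [Complex.exp_mul_I]
  rw [hdiag, Matrix.exp_conj _ _ hunit, Matrix.exp_diagonal, hexp, hd]
  have hI := Complex.I_mul_I
  ext i j
  fin_cases i <;> fin_cases j <;> simp
  · linear_combination Complex.sin θ * hI
  · linear_combination -Complex.sin θ * hI

lemma gateD_eq : gateD = !![(Real.cos (Real.pi / 8) : ℂ), -(Real.sin (Real.pi / 8) : ℂ);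
    (Real.sin (Real.pi / 8) : ℂ), (Real.cos (Real.pi / 8) : ℂ)] :=
  exp_neg_I_mul_smul_Y _

lemma conjTranspose_gateD :
    gateDᴴ = !![(Real.cos (Real.pi / 8) : ℂ), (Real.sin (Real.pi / 8) : ℂ);
      -(Real.sin (Real.pi / 8) : ℂ), (Real.cos (Real.pi / 8) : ℂ)] := by
  rw [gateD_eq]
  generalize Real.cos (Real.pi / 8) = c
  generalize Real.sin (Real.pi / 8) = s
  ext i j
  fin_cases i <;> fin_cases j <;> simp [Matrix.conjTranspose_apply]

lemma gateD_mul_conjTranspose : gateD * gateDᴴ = 1 := by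
  have h := Real.sin_sq_add_cos_sq (Real.pi / 8)
  rw [conjTranspose_gateD, gateD_eq]
  generalize Real.cos (Real.pi / 8) = c at *
  generalize Real.sin (Real.pi / 8) = s at *
  have h' : (s : ℂ) ^ 2 + (c : ℂ) ^ 2 = 1 := by exact_mod_cast h
  rw [Matrix.mul_fin_two, Matrix.one_fin_two]
  congr 1
  ext i j
  fin_cases i <;> fin_cases j <;> simp
  · linear_combination h'
  · ring
  · ring
  · linear_combination h'

/-- The single-qubit factors of a rotated Pauli operator. -/
noncomputable def rotLetter (L : Letter) : Matrix (Fin 2) (Fin 2) ℂ :=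
  gateDᴴ * L.toMatrix * gateD

lemma rotLetter_I : rotLetter .I = 1 := by
  rw [rotLetter, Letter.toMatrix, mul_one]
  exact mul_eq_one_comm.1 gateD_mul_conjTranspose

lemma sqrt_two_inv_eq : (√2 : ℝ)⁻¹ = √2 / 2 := by
  rw [eq_div_iff (by norm_num), inv_mul_eq_iff_eq_mul₀ (by positivity)]
  simp

lemma two_mul_sin_mul_cos_pi_div_eight :
    2 * (Real.sin (Real.pi / 8) : ℂ) * (Real.cos (Real.pi / 8) : ℂ) = ((√2 : ℝ) : ℂ)⁻¹ := by
  have h : 2 * Real.sin (Real.pi / 8) * Real.cos (Real.pi / 8) = (√2)⁻¹ := by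
    rw [← Real.sin_two_mul, sqrt_two_inv_eq, ← Real.sin_pi_div_four]; congr 1; ring
  rw [← Complex.ofReal_inv, ← h]
  push_cast [-Complex.ofReal_cos, -Complex.ofReal_sin]
  rfl

lemma cos_sq_sub_sin_sq_pi_div_eight :
    (Real.cos (Real.pi / 8) : ℂ) ^ 2 - (Real.sin (Real.pi / 8) : ℂ) ^ 2 = ((√2 : ℝ) : ℂ)⁻¹ := by
  have h : Real.cos (Real.pi / 8) ^ 2 - Real.sin (Real.pi / 8) ^ 2 = (√2)⁻¹ := by
    rw [← Real.cos_two_mul', sqrt_two_inv_eq, ← Real.cos_pi_div_four]; congr 1; ring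
  rw [← Complex.ofReal_inv, ← h]
  push_cast [-Complex.ofReal_cos, -Complex.ofReal_sin]
  rfl

/-- Conjugation by the rotation turns `X` into the Hadamard gate. -/
lemma rotLetter_X : rotLetter .X = ((√2 : ℝ) : ℂ)⁻¹ • !![1, 1; 1, -1] := by
  have h1 := two_mul_sin_mul_cos_pi_div_eight
  have h2 := cos_sq_sub_sin_sq_pi_div_eight
  rw [rotLetter, conjTranspose_gateD, gateD_eq, Letter.toMatrix]
  generalize (Real.cos (Real.pi / 8) : ℂ) = c at *
  generalize (Real.sin (Real.pi / 8) : ℂ) = s at *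
  rw [Matrix.mul_fin_two, Matrix.mul_fin_two]
  ext i j
  fin_cases i <;> fin_cases j <;> simp
  · linear_combination h1
  · linear_combination h2
  · linear_combination h2
  · linear_combination -h1

/-- Conjugation by the rotation turns `Z` into a signed Hadamard gate. -/
lemma rotLetter_Z : rotLetter .Z = ((√2 : ℝ) : ℂ)⁻¹ • !![1, -1; -1, -1] := by
  have h1 := two_mul_sin_mul_cos_pi_div_eight
  have h2 := cos_sq_sub_sin_sq_pi_div_eight
  rw [rotLetter, conjTranspose_gateD, gateD_eq, Letter.toMatrix]
  generalize (Real.cos (Real.pi / 8) : ℂ) = c at *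
  generalize (Real.sin (Real.pi / 8) : ℂ) = s at *
  rw [Matrix.mul_fin_two, Matrix.mul_fin_two]
  ext i j
  fin_cases i <;> fin_cases j <;> simp
  · linear_combination h2
  · linear_combination -h1
  · linear_combination -h1
  · linear_combination -h2

/-- The rotated letters other than `Y` normalize the Pauli group of a qubit. -/
lemma rotLetter_conj {L : Letter} (hL : L ≠ .Y) (M : Letter) :
    ∃ (s : ℕ) (K : Letter),
      rotLetter L * M.toMatrix * rotLetter L = Complex.I ^ s • K.toMatrix := by
  have hs : (((√2 : ℝ) : ℂ))⁻¹ * (((√2 : ℝ) : ℂ))⁻¹ = 1 / 2 := by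
    rw [← Complex.ofReal_inv, ← Complex.ofReal_mul, ← mul_inv, Real.mul_self_sqrt (by norm_num)]
    norm_num
  have key : ∀ (s : ℕ) (K : Letter),
      rotLetter L * M.toMatrix * rotLetter L = Complex.I ^ s • K.toMatrix →
      ∃ (s : ℕ) (K : Letter), rotLetter L * M.toMatrix * rotLetter L = Complex.I ^ s • K.toMatrix :=
    fun s K h => ⟨s, K, h⟩
  cases L
  case I => exact ⟨0, M, by simp [rotLetter_I]⟩
  case Y => exact absurd rfl hL
  all_goals
    simp only [rotLetter_X, rotLetter_Z, Matrix.smul_mul, Matrix.mul_smul, smul_smul, hs] at key ⊢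
    cases M
  on_goal 1 => apply key 0 .I
  on_goal 2 => apply key 0 .Z
  on_goal 3 => apply key 2 .Y
  on_goal 4 => apply key 0 .X
  on_goal 5 => apply key 0 .I
  on_goal 6 => apply key 2 .Z
  on_goal 7 => apply key 2 .Y
  on_goal 8 => apply key 2 .X
  all_goals
    ext i j
    fin_cases i <;> fin_cases j <;>
      simp [Letter.toMatrix] <;> ring

lemma rotated_pauliString (L : Fin n → Letter) :
    rotated (pauliString L) = tensor fun i => rotLetter (L i) := by
  simp [rotated, pauliString, tensor_mul, rotLetter]

lemma tensor_gateD_mul_conjTranspose :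
    (tensor fun _ : Fin n => gateD) * (tensor fun _ => gateDᴴ) = 1 := by
  simp [tensor_mul, gateD_mul_conjTranspose, tensor_one]

lemma tensor_conjTranspose_gateD_mul :
    (tensor fun _ : Fin n => gateDᴴ) * (tensor fun _ => gateD) = 1 :=
  mul_eq_one_comm.1 tensor_gateD_mul_conjTranspose

lemma rotated_one : rotated (1 : Op n) = 1 := by
  rw [rotated, Matrix.mul_one, tensor_conjTranspose_gateD_mul]

lemma rotated_sub (A B : Op n) : rotated (A - B) = rotated A - rotated B := by
  simp [rotated, Matrix.mul_sub, Matrix.sub_mul]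

lemma rotated_smul (c : ℂ) (A : Op n) : rotated (c • A) = c • rotated A := by
  simp [rotated]

lemma rotated_sum {ι : Type*} (s : Finset ι) (f : ι → Op n) :
    rotated (∑ i ∈ s, f i) = ∑ i ∈ s, rotated (f i) := by
  simp [rotated, Finset.mul_sum, Finset.sum_mul]

lemma rotated_mul (A B : Op n) : rotated A * rotated B = rotated (A * B) := by
  calc rotated A * rotated B = (tensor fun _ => gateDᴴ) * A *
        ((tensor fun _ => gateD) * (tensor fun _ => gateDᴴ)) * B * (tensor fun _ => gateD) := by
        simp only [rotated, Matrix.mul_assoc]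
    _ = rotated (A * B) := by
        rw [tensor_gateD_mul_conjTranspose, Matrix.mul_one, rotated, Matrix.mul_assoc _ A B]

lemma conjTranspose_rotated (A : Op n) : (rotated A)ᴴ = rotated Aᴴ := by
  simp [rotated, Matrix.conjTranspose_mul, conjTranspose_tensor, Matrix.mul_assoc]

lemma trace_rotated (A : Op n) : (rotated A).trace = A.trace := by
  rw [rotated, Matrix.trace_mul_cycle, tensor_gateD_mul_conjTranspose, Matrix.one_mul]

end Rotation

/-! ### Gaussian rationals -/

section GaussianRational

variable {n : ℕ}

/-- The field `ℚ(i)` of Gaussian rationals, as a subring of `ℂ`. -/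
def gaussianRational : Subring ℂ where
  carrier := {z | ∃ a b : ℚ, z = a + b * Complex.I}
  mul_mem' := by
    rintro _ _ ⟨a, b, rfl⟩ ⟨c, d, rfl⟩
    refine ⟨a * c - b * d, a * d + b * c, ?_⟩
    push_cast
    linear_combination (b * d : ℂ) * Complex.I_mul_I
  one_mem' := ⟨1, 0, by simp⟩
  add_mem' := by
    rintro _ _ ⟨a, b, rfl⟩ ⟨c, d, rfl⟩
    exact ⟨a + c, b + d, by push_cast; ring⟩
  zero_mem' := ⟨0, 0, by simp⟩
  neg_mem' := by
    rintro _ ⟨a, b, rfl⟩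
    exact ⟨-a, -b, by push_cast; ring⟩

lemma ratCast_mem_gaussianRational (q : ℚ) : (q : ℂ) ∈ gaussianRational := ⟨q, 0, by simp⟩

lemma I_mem_gaussianRational : Complex.I ∈ gaussianRational := ⟨0, 1, by simp⟩

/-- An odd power of `√2` is not a Gaussian rational. -/
lemma sqrt_two_pow_notMem_gaussianRational {k : ℕ} (hk : Odd k) :
    ((√2 : ℝ) : ℂ) ^ k ∉ gaussianRational := by
  rintro ⟨a, b, h⟩
  obtain ⟨m, rfl⟩ := hk
  have h1 := congrArg Complex.re h
  rw [← Complex.ofReal_pow, Complex.ofReal_re, pow_succ, pow_mul, Real.sq_sqrt (by norm_num)] at h1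
  simp only [Complex.add_re, Complex.ratCast_re, Complex.mul_re, Complex.I_re, Complex.ratCast_im,
    Complex.I_im] at h1
  refine irrational_sqrt_two ⟨a / 2 ^ m, ?_⟩
  push_cast
  rw [div_eq_iff (by positivity)]
  linarith

lemma tensor_apply_mem_gaussianRational {f : Fin n → Matrix (Fin 2) (Fin 2) ℂ}
    (hf : ∀ i a b, f i a b ∈ gaussianRational) (x y : Bits n) :
    tensor f x y ∈ gaussianRational :=
  Subring.prod_mem (t := Finset.univ) (f := fun i => f i (x i) (y i)) _ fun i _ => hf i _ _

lemma apply_mem_gaussianRational_of_mem_pauliGroup {A : Op n} (hA : A ∈ pauliGroup n)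
    (x y : Bits n) : A x y ∈ gaussianRational := by
  obtain ⟨s, L, rfl⟩ := mem_pauliGroup_iff.1 hA
  refine Subring.mul_mem _ (Subring.pow_mem _ I_mem_gaussianRational s)
    (tensor_apply_mem_gaussianRational (fun i a b => ?_) x y)
  have h0 := gaussianRational.zero_mem
  have h1 := gaussianRational.one_mem
  have hI := I_mem_gaussianRational
  cases L i <;> fin_cases a <;> fin_cases b <;>
    simp [Letter.toMatrix, h0, h1, hI, gaussianRational.neg_mem]

lemma groupProj_apply_mem_gaussianRational {F : Finset (Op n)} (hF : IsStabilizerFinset F)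
    (x y : Bits n) : groupProj F x y ∈ gaussianRational := by
  rw [groupProj, Matrix.smul_apply, Matrix.sum_apply]
  refine Subring.mul_mem _ ?_
    (Subring.sum_mem _ fun A hA => apply_mem_gaussianRational_of_mem_pauliGroup (hF.pauli A hA) x y)
  have := ratCast_mem_gaussianRational ((F.card : ℚ)⁻¹)
  push_cast at this
  exact this

/-- Each rotated letter `X` or `Z` contributes one factor `1 / √2` to an otherwise integral
tensor product. -/
lemma exists_rotated_pauliString {L : Fin n → Letter} (hL : ∀ i, L i ≠ .Y) :
    ∃ M : Op n, (∀ x y, M x y ∈ gaussianRational) ∧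
      rotated (pauliString L) =
        (((√2 : ℝ) : ℂ)⁻¹) ^ (Finset.univ.filter fun i => L i ≠ .I).card • M := by
  have h0 := gaussianRational.zero_mem
  have h1 := gaussianRational.one_mem
  have key : ∀ K : Letter, K ≠ .Y → ∃ M : Matrix (Fin 2) (Fin 2) ℂ,
      (∀ a b, M a b ∈ gaussianRational) ∧
      rotLetter K = (if K ≠ .I then ((√2 : ℝ) : ℂ)⁻¹ else 1) • M := by
    intro K hK
    cases K
    · refine ⟨1, fun a b => ?_, by simp [rotLetter_I]⟩
      fin_cases a <;> fin_cases b <;> simp [h0, h1]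
    · refine ⟨!![1, 1; 1, -1], fun a b => ?_, by simp [rotLetter_X]⟩
      fin_cases a <;> fin_cases b <;> simp [h1, gaussianRational.neg_mem]
    · exact absurd rfl hK
    · refine ⟨!![1, -1; -1, -1], fun a b => ?_, by simp [rotLetter_Z]⟩
      fin_cases a <;> fin_cases b <;> simp [h1, gaussianRational.neg_mem]
  choose M hM hM' using fun i => key (L i) (hL i)
  refine ⟨tensor M, tensor_apply_mem_gaussianRational hM, ?_⟩
  rw [rotated_pauliString, Finset.card_filter, ← Finset.prod_pow_eq_pow_sum]
  rw [← tensor_smul]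
  congr 1
  funext i
  rw [hM' i]
  split_ifs <;> simp

end GaussianRational

/-! ### Overlaps of stabilizer states -/

section Overlap

variable {n : ℕ}

lemma isHermitian_rotated_pauliString (L : Fin n → Letter) :
    (rotated (pauliString L)).IsHermitian := by
  rw [Matrix.IsHermitian, conjTranspose_rotated, conjTranspose_pauliString]

lemma rotated_pauliString_mul_self (L : Fin n → Letter) :
    rotated (pauliString L) * rotated (pauliString L) = 1 := by
  rw [rotated_mul, pauliString_mul_self, rotated_one]

/-- The rotated Pauli strings without `Y` are Clifford operators. -/
lemma rotated_conj_mem_pauliGroup {L : Fin n → Letter} (hL : ∀ i, L i ≠ .Y) {A : Op n}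
    (hA : A ∈ pauliGroup n) :
    rotated (pauliString L) * A * rotated (pauliString L) ∈ pauliGroup n := by
  obtain ⟨s, M, rfl⟩ := mem_pauliGroup_iff.1 hA
  rw [Matrix.mul_smul, Matrix.smul_mul]
  refine smul_I_pow_mem_pauliGroup ?_ s
  rw [rotated_pauliString, pauliString, tensor_mul, tensor_mul]
  exact tensor_mem_pauliGroup _ fun i => rotLetter_conj (hL i) _

lemma dotProduct_mulVec_of_isHermitian {A : Op n} (hA : A.IsHermitian) (v w : Bits n → ℂ) :
    star (A *ᵥ v) ⬝ᵥ w = star v ⬝ᵥ A *ᵥ w := by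
  rw [star_mulVec, hA.eq, dotProduct_mulVec]

/-- A Hermitian Pauli operator either fixes a pure stabilizer state up to a sign or maps it to an
orthogonal state. -/
lemma IsPureStabilizerState.eigenvector_or_orthogonal {φ : Bits n → ℂ}
    (hφ : IsPureStabilizerState φ) {A : Op n} (hA : A ∈ pauliGroup n) (hA2 : A * A = 1) :
    A *ᵥ φ = φ ∨ A *ᵥ φ = -φ ∨ star φ ⬝ᵥ A *ᵥ φ = 0 := by
  obtain ⟨F, hF, hmem, hproj⟩ := hφ.exists_groupProj
  by_cases hcomm : ∀ B ∈ F, A * B = B * A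
  · -- `A` commutes with the rank-one projector onto `φ`, so `φ` is an eigenvector.
    have h : A * groupProj F = groupProj F * A := by
      rw [groupProj, Matrix.mul_smul, Matrix.smul_mul, Finset.mul_sum, Finset.sum_mul,
        Finset.sum_congr rfl hcomm]
    have h1 : A *ᵥ φ = (star φ ⬝ᵥ A *ᵥ φ) • φ := by
      have h2 := congrArg (· *ᵥ φ) h
      simp only [hproj, ← mulVec_mulVec, vecMulVec_mulVec, hφ.1] at h2
      simpa using h2
    set c := star φ ⬝ᵥ A *ᵥ φ with hc
    have h3 : (c * c) • φ = φ := by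
      rw [mul_smul, ← h1, ← mulVec_smul, ← h1, mulVec_mulVec, hA2, one_mulVec]
    have h4 : c * c = 1 := by
      have := congrArg (star φ ⬝ᵥ ·) h3
      simpa [dotProduct_smul, hφ.1] using this
    rcases mul_self_eq_one_iff.1 h4 with h | h
    · left; rw [h1, h, one_smul]
    · right; left; rw [h1, h, neg_one_smul]
  · push Not at hcomm
    obtain ⟨B, hB, hAB⟩ := hcomm
    have hanti := (commute_or_anticommute hA (hF.pauli B hB)).resolve_left hAB
    have hBφ : B *ᵥ φ = φ := ((hmem B).1 hB).2
    right; right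
    have h : star φ ⬝ᵥ A *ᵥ φ = -(star φ ⬝ᵥ A *ᵥ φ) := by
      calc star φ ⬝ᵥ A *ᵥ φ = star φ ⬝ᵥ (A * B) *ᵥ φ := by rw [← mulVec_mulVec, hBφ]
        _ = -(star φ ⬝ᵥ B *ᵥ A *ᵥ φ) := by
            rw [hanti, neg_mulVec, dotProduct_neg, mulVec_mulVec]
        _ = -(star φ ⬝ᵥ A *ᵥ φ) := by
            rw [← dotProduct_mulVec_of_isHermitian (hF.isHermitian hB), hBφ]
    exact self_eq_neg.1 h

/-- The overlap of a unit vector with its image under a Hermitian involution is at most `1`. -/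
lemma overlap_le_one {φ : Bits n → ℂ} (hφ : star φ ⬝ᵥ φ = 1) {C : Op n} (hC : C.IsHermitian)
    (hC2 : C * C = 1) : (star φ ⬝ᵥ C *ᵥ φ).re ≤ 1 := by
  have h := dotProduct_star_self_nonneg (φ - C *ᵥ φ)
  have h1 : star (C *ᵥ φ) ⬝ᵥ φ = star φ ⬝ᵥ C *ᵥ φ := dotProduct_mulVec_of_isHermitian hC _ _
  have h2 : star (C *ᵥ φ) ⬝ᵥ C *ᵥ φ = 1 := by
    rw [dotProduct_mulVec_of_isHermitian hC, mulVec_mulVec, hC2, one_mulVec, hφ]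
  rw [star_sub, sub_dotProduct, dotProduct_sub, dotProduct_sub, h1, h2, hφ] at h
  have := (Complex.le_def.1 h).1
  simp at this
  linarith

/-- The overlap of a pure stabilizer state with its image under a Hermitian Clifford involution
that is an odd power of `1 / √2` times a matrix over `ℚ(i)` is at most `1 / √2`. If the Clifford
operator preserves the stabilizer, the overlap would be `±1`, which is excluded as `√2` is not in
`ℚ(i)`; otherwise some Pauli operator fixes one of the two states and not the other. -/
lemma IsPureStabilizerState.overlap_le {φ : Bits n → ℂ} (hφ : IsPureStabilizerState φ) {C : Op n}
    (hC : C.IsHermitian) (hC2 : C * C = 1)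
    (hcliff : ∀ A ∈ pauliGroup n, C * A * C ∈ pauliGroup n) {k : ℕ} (hk : Odd k) {M : Op n}
    (hM : ∀ x y, M x y ∈ gaussianRational) (hCM : C = (((√2 : ℝ) : ℂ)⁻¹) ^ k • M) :
    (star φ ⬝ᵥ C *ᵥ φ).re ≤ (√2)⁻¹ := by
  obtain ⟨F, hF, hmem, hproj⟩ := hφ.exists_groupProj
  have hCC : star (C *ᵥ φ) ⬝ᵥ C *ᵥ φ = 1 := by
    rw [dotProduct_mulVec_of_isHermitian hC, mulVec_mulVec, hC2, one_mulVec, hφ.1]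
  set a := star φ ⬝ᵥ C *ᵥ φ with ha
  have hCa : star (C *ᵥ φ) ⬝ᵥ φ = a := dotProduct_mulVec_of_isHermitian hC _ _
  by_cases hfix : ∀ B ∈ F, B *ᵥ C *ᵥ φ = C *ᵥ φ
  · exfalso
    have h1 : C *ᵥ φ = a • φ := by
      have h : groupProj F *ᵥ C *ᵥ φ = C *ᵥ φ := by
        rw [groupProj, smul_mulVec, Matrix.sum_mulVec, Finset.sum_congr rfl hfix, Finset.sum_const,
          ← Nat.cast_smul_eq_nsmul ℂ, smul_smul, inv_mul_cancel₀ hF.card_ne_zero, one_smul]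
      rw [← h, hproj, vecMulVec_mulVec]
      simp [ha]
    have h2 : a * a = 1 := by
      rw [h1, dotProduct_smul, ← h1, hCa, smul_eq_mul] at hCC
      exact hCC
    have h3 : a = (((√2 : ℝ) : ℂ)⁻¹) ^ k * (groupProj F * M).trace := by
      rw [ha, hproj, ← smul_eq_mul, ← Matrix.trace_smul, ← Matrix.mul_smul, ← hCM, vecMulVec_mul,
        trace_vecMulVec, dotProduct_comm φ, ← dotProduct_mulVec]
    have h4 : (groupProj F * M).trace ∈ gaussianRational :=
      Subring.sum_mem _ fun x _ => Subring.sum_mem _ fun y _ =>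
        Subring.mul_mem _ (groupProj_apply_mem_gaussianRational hF x y) (hM y x)
    apply sqrt_two_pow_notMem_gaussianRational hk
    have h5 : ((√2 : ℝ) : ℂ) ^ k ≠ 0 := by simp
    rw [inv_pow, eq_inv_mul_iff_mul_eq₀ h5] at h3
    rcases mul_self_eq_one_iff.1 h2 with h | h <;> rw [h] at h3
    · rwa [← h3, mul_one] at h4
    · rw [← h3, mul_neg_one] at h4
      exact neg_mem_iff.1 h4
  · push Not at hfix
    obtain ⟨B, hB, hBC⟩ := hfix
    have hB' := (hmem B).1 hB
    -- `U` fixes `C φ` but not `φ`.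
    set U := C * B * C with hU
    have hUC : U *ᵥ C *ᵥ φ = C *ᵥ φ := by
      rw [hU, mulVec_mulVec, Matrix.mul_assoc, hC2, Matrix.mul_one, ← mulVec_mulVec, hB'.2]
    have hU2 : U * U = 1 := by
      calc U * U = C * (B * (C * C) * B) * C := by simp only [hU, Matrix.mul_assoc]
        _ = 1 := by rw [hC2, Matrix.mul_one, hF.mul_self hB, Matrix.mul_one, hC2]
    have hUH : U.IsHermitian := by
      rw [hU, Matrix.IsHermitian, conjTranspose_mul, conjTranspose_mul, hC.eq,
        (hF.isHermitian hB).eq, Matrix.mul_assoc]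
    have hUφ : U *ᵥ φ ≠ φ := by
      intro h
      apply hBC
      have := congrArg (C *ᵥ ·) h
      simpa only [hU, mulVec_mulVec, ← Matrix.mul_assoc, hC2, Matrix.one_mul] using this
    have hUa : star (U *ᵥ φ) ⬝ᵥ C *ᵥ φ = a := by
      rw [dotProduct_mulVec_of_isHermitian hUH, hUC]
    rcases hφ.eigenvector_or_orthogonal (hcliff B hB'.1) hU2 with h | h | h
    · exact absurd h hUφ
    · have h0 : a = 0 := by
        rw [h, star_neg, neg_dotProduct] at hUa
        exact self_eq_neg.1 hUa.symm
      rw [h0]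
      simp
    · -- `C φ` has overlap `2 a` with the vector `φ + U φ` of squared norm `2`.
      have hUU : star (U *ᵥ φ) ⬝ᵥ U *ᵥ φ = 1 := by
        rw [dotProduct_mulVec_of_isHermitian hUH, mulVec_mulVec, hU2, one_mulVec, hφ.1]
      have hU0 : star (U *ᵥ φ) ⬝ᵥ φ = 0 := by
        rw [dotProduct_mulVec_of_isHermitian hUH, h]
      have hCU : star (C *ᵥ φ) ⬝ᵥ U *ᵥ φ = a := by
        rw [← dotProduct_mulVec_of_isHermitian hUH, hUC, hCa]
      have h' : star φ ⬝ᵥ U *ᵥ φ = 0 := h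
      have hs : √2 * √2 = 2 := Real.mul_self_sqrt (by norm_num)
      have hs' : ((√2 : ℝ) : ℂ) * ((√2 : ℝ) : ℂ) = 2 := by exact_mod_cast hs
      have hpos := dotProduct_star_self_nonneg (φ + U *ᵥ φ - ((√2 : ℝ) : ℂ) • C *ᵥ φ)
      have hexp : star (φ + U *ᵥ φ - ((√2 : ℝ) : ℂ) • C *ᵥ φ) ⬝ᵥ
          (φ + U *ᵥ φ - ((√2 : ℝ) : ℂ) • C *ᵥ φ) = 4 - 4 * ((√2 : ℝ) : ℂ) * a := by
        have hst : star ((√2 : ℝ) : ℂ) = ((√2 : ℝ) : ℂ) := Complex.conj_ofReal _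
        simp only [star_sub, star_add, star_smul, hst, sub_dotProduct, add_dotProduct,
          dotProduct_sub, dotProduct_add, smul_dotProduct, dotProduct_smul, hφ.1, hUU, hU0, hCU,
          h', hCC, hCa, hUa, ← ha, smul_eq_mul]
        linear_combination hs'
      rw [hexp] at hpos
      have hre := (Complex.le_def.1 hpos).1
      have : (4 * ((√2 : ℝ) : ℂ) * a).re = 4 * (√2 * a.re) := by
        rw [mul_assoc, ← Complex.re_ofReal_mul]
        simp
      rw [Complex.sub_re, this] at hre
      simp only [Complex.zero_re, Complex.re_ofNat] at hre
      rw [← one_div, le_div_iff₀' (by positivity)]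
      linarith

end Overlap

/-! ### Energies -/

section Energy

variable {n : ℕ}

lemma energy_rotated_stabilizerHamiltonian (S : Finset (PauliElement n)) (ρ : Op n) :
    energy (rotated (stabilizerHamiltonian S)) ρ =
      (S.card : ℝ)⁻¹ * ∑ P ∈ S, energy (rotated P.proj) ρ := by
  rw [stabilizerHamiltonian, rotated_smul, rotated_sum, energy, Matrix.mul_smul, Matrix.trace_smul,
    Finset.mul_sum, Matrix.trace_sum, smul_eq_mul, one_div, ← Complex.ofReal_natCast,
    ← Complex.ofReal_inv, Complex.re_ofReal_mul, Complex.re_sum]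
  rfl

/-- The energy of a rotated check in a pure state is governed by the overlap of the state with its
image under the rotated Pauli string. -/
lemma energy_rotated_proj {P : PauliElement n} (hP : P.toOp = pauliString P.letter)
    {φ : Bits n → ℂ} (hφ : star φ ⬝ᵥ φ = 1) :
    energy (rotated P.proj) (vecMulVec φ (star φ)) =
      (1 - (star φ ⬝ᵥ rotated (pauliString P.letter) *ᵥ φ).re) / 2 := by
  rw [energy, PauliElement.proj, rotated_smul, rotated_sub, rotated_one, hP, Matrix.mul_smul,
    Matrix.trace_smul, Matrix.mul_sub, Matrix.mul_one, Matrix.trace_sub, trace_vecMulVec,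
    vecMulVec_mul, trace_vecMulVec, dotProduct_comm φ, dotProduct_comm φ, ← dotProduct_mulVec, hφ]
  have : (1 / 2 : ℂ) = ((1 / 2 : ℝ) : ℂ) := by push_cast; rfl
  rw [smul_eq_mul, this, Complex.re_ofReal_mul]
  simp
  ring

lemma PauliElement.toOp_eq_pauliString {P : PauliElement n} (hP : P.IsXType ∨ P.IsZType) :
    P.toOp = pauliString P.letter := by
  have : P.phase = 0 := by rcases hP with h | h <;> exact h.1
  simp [PauliElement.toOp, this, pauliString]

lemma PauliElement.letter_ne_Y {P : PauliElement n} (hP : P.IsXType ∨ P.IsZType) (i : Fin n) :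
    P.letter i ≠ .Y := by
  intro h
  rcases hP with hP | hP <;> rcases hP.2 i with h' | h' <;> simp [h] at h'

lemma sin_sq_pi_div_eight : Real.sin (Real.pi / 8) ^ 2 = (1 - (√2)⁻¹) / 2 := by
  have h : Real.cos (Real.pi / 4) = 1 - 2 * Real.sin (Real.pi / 8) ^ 2 := by
    rw [Real.sin_sq, show Real.pi / 4 = 2 * (Real.pi / 8) by ring, Real.cos_two_mul]; ring
  rw [Real.cos_pi_div_four, ← sqrt_two_inv_eq] at h
  linarith

lemma PauliElement.energy_nonneg_of_pure {P : PauliElement n} (hP : P.IsXType ∨ P.IsZType)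
    {φ : Bits n → ℂ} (hφ : star φ ⬝ᵥ φ = 1) :
    0 ≤ energy (rotated P.proj) (vecMulVec φ (star φ)) := by
  rw [energy_rotated_proj (PauliElement.toOp_eq_pauliString hP) hφ]
  have := overlap_le_one hφ (isHermitian_rotated_pauliString P.letter)
    (rotated_pauliString_mul_self P.letter)
  linarith

/-- Every pure stabilizer state violates every rotated check of odd weight by at least
`sin² (π / 8)`. -/
lemma PauliElement.sin_sq_le_energy {P : PauliElement n} (hP : P.IsXType ∨ P.IsZType)
    (hodd : Odd P.weight) {φ : Bits n → ℂ} (hφ : IsPureStabilizerState φ) :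
    Real.sin (Real.pi / 8) ^ 2 ≤ energy (rotated P.proj) (vecMulVec φ (star φ)) := by
  rw [energy_rotated_proj (PauliElement.toOp_eq_pauliString hP) hφ.1, sin_sq_pi_div_eight]
  have hY := PauliElement.letter_ne_Y hP
  obtain ⟨M, hM, hCM⟩ := exists_rotated_pauliString hY
  have := hφ.overlap_le (isHermitian_rotated_pauliString P.letter)
    (rotated_pauliString_mul_self P.letter) (fun A hA => rotated_conj_mem_pauliGroup hY hA)
    hodd hM hCM
  linarith

lemma convex_setOf_le_energy (H : Op n) (c : ℝ) : Convex ℝ {ψ | c ≤ energy H ψ} := by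
  intro ψ hψ χ hχ a b ha hb hab
  simp only [Set.mem_ofPred_eq] at hψ hχ ⊢
  have h : energy H (a • ψ + b • χ) = a * energy H ψ + b * energy H χ := by
    simp [energy, Matrix.add_mul]
  rw [h]
  calc c = a * c + b * c := by rw [← add_mul, hab, one_mul]
    _ ≤ _ := by gcongr

/-- The energy of a stabilizer state is at least the fraction of odd-weight checks times
`sin² (π / 8)`. -/
theorem le_energy_of_isStabilizerState {S : Finset (PauliElement n)} (hne : S.Nonempty)
    (hS : ∀ P ∈ S, P.IsXType ∨ P.IsZType) {α : ℝ}
    (hodd : α * (S.card : ℝ) ≤ ((S.filter fun P => Odd P.weight).card : ℝ))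
    {ψ : Op n} (hψ : IsStabilizerState ψ) :
    α * Real.sin (Real.pi / 8) ^ 2 ≤ energy (rotated (stabilizerHamiltonian S)) ψ := by
  refine convexHull_min ?_ (convex_setOf_le_energy _ _) hψ
  rintro _ ⟨φ, hφ, rfl⟩
  have hcard : (0 : ℝ) < S.card := by exact_mod_cast hne.card_pos
  rw [Set.mem_ofPred_eq, energy_rotated_stabilizerHamiltonian, le_inv_mul_iff₀ hcard]
  calc (S.card : ℝ) * (α * Real.sin (Real.pi / 8) ^ 2)
      = α * S.card * Real.sin (Real.pi / 8) ^ 2 := by ring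
    _ ≤ (S.filter fun P => Odd P.weight).card * Real.sin (Real.pi / 8) ^ 2 := by gcongr
    _ = ∑ P ∈ S with Odd P.weight, Real.sin (Real.pi / 8) ^ 2 := by
        rw [Finset.sum_const, nsmul_eq_mul]
    _ ≤ ∑ P ∈ S with Odd P.weight, energy (rotated P.proj) (vecMulVec φ (star φ)) :=
        Finset.sum_le_sum fun P hP => by
          rw [Finset.mem_filter] at hP
          exact PauliElement.sin_sq_le_energy (hS P hP.1) hP.2 hφ
    _ ≤ ∑ P ∈ S, energy (rotated P.proj) (vecMulVec φ (star φ)) :=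
        Finset.sum_le_sum_of_subset_of_nonneg (Finset.filter_subset _ _) fun P hP _ =>
          PauliElement.energy_nonneg_of_pure (hS P hP) hφ.1

end Energy

/-! ### The ground-state energy -/

section GroundEnergy

variable {n : ℕ}

lemma isHermitian_proj {P : PauliElement n} (hP : P.toOp = pauliString P.letter) :
    P.proj.IsHermitian := by
  rw [PauliElement.proj, hP, Matrix.IsHermitian, conjTranspose_smul, conjTranspose_sub,
    conjTranspose_pauliString, conjTranspose_one]
  simp

lemma proj_mul_self {P : PauliElement n} (hP : P.toOp = pauliString P.letter) :
    P.proj * P.proj = P.proj := by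
  rw [PauliElement.proj, hP, Matrix.smul_mul, Matrix.mul_smul, smul_smul, Matrix.mul_sub,
    Matrix.sub_mul, Matrix.sub_mul, pauliString_mul_self]
  simp only [Matrix.mul_one, Matrix.one_mul]
  module

lemma isHermitian_rotated_proj {P : PauliElement n} (hP : P.toOp = pauliString P.letter) :
    (rotated P.proj).IsHermitian := by
  rw [Matrix.IsHermitian, conjTranspose_rotated, (isHermitian_proj hP).eq]

lemma rotated_proj_mul_self {P : PauliElement n} (hP : P.toOp = pauliString P.letter) :
    rotated P.proj * rotated P.proj = rotated P.proj := by
  rw [rotated_mul, proj_mul_self hP]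

lemma energy_nonneg_of_idempotent {K ρ : Op n} (hK : K.IsHermitian) (hK2 : K * K = K)
    (hρ : ρ.PosSemidef) : 0 ≤ energy K ρ := by
  have h := (hρ.conjTranspose_mul_mul_same K).trace_nonneg
  rw [hK.eq, Matrix.trace_mul_cycle, hK2, Matrix.trace_mul_comm] at h
  exact (Complex.le_def.1 h).1

/-- A CSS code has a code state, which has energy zero, so the ground-state energy of its
(rotated) Hamiltonian is not positive. -/
lemma groundEnergy_nonpos {S : Finset (PauliElement n)} (hS : GeneratesCSS S) :
    groundEnergy (rotated (stabilizerHamiltonian S)) ≤ 0 := by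
  obtain ⟨⟨hpauli, -, hneg⟩, htype⟩ := hS
  have hfin : {A : Op n | ∃ g ∈ generated S, (g : Op n) = A}.Finite :=
    finite_pauliGroup.subset fun A ⟨g, hg, h⟩ => h ▸ hpauli g hg
  set F := hfin.toFinset with hFdef
  have hmem : ∀ A, A ∈ F ↔ ∃ g ∈ generated S, (g : Op n) = A := fun A => hfin.mem_toFinset
  have hF : IsStabilizerFinset F := by
    refine ⟨fun A hA => ?_, (hmem _).2 ⟨1, one_mem _, rfl⟩, fun A hA B hB => ?_, fun h => ?_⟩
    · obtain ⟨g, hg, rfl⟩ := (hmem A).1 hA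
      exact hpauli g hg
    · obtain ⟨g, hg, rfl⟩ := (hmem A).1 hA
      obtain ⟨k, hk, rfl⟩ := (hmem B).1 hB
      exact (hmem _).2 ⟨g * k, mul_mem hg hk, rfl⟩
    · obtain ⟨g, hg, h⟩ := (hmem _).1 h
      have : g = -1 := Units.ext (by simpa using h)
      exact hneg (this ▸ hg)
  -- The code state is the maximally mixed state of the code space.
  set d : ℂ := (F.card : ℂ)⁻¹ * 2 ^ n with hd
  have hd0 : d ≠ 0 := mul_ne_zero (inv_ne_zero hF.card_ne_zero) (by simp)
  have hdpos : 0 ≤ d⁻¹ := by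
    have : d⁻¹ = (((F.card : ℝ)⁻¹ * 2 ^ n)⁻¹ : ℝ) := by push_cast; rfl
    rw [this]
    exact Complex.zero_le_real.2 (by positivity)
  set ρ : Op n := d⁻¹ • rotated (groupProj F) with hρ
  have hQ : (rotated (groupProj F)).PosSemidef := by
    apply posSemidef_of_idempotent
    · rw [Matrix.IsHermitian, conjTranspose_rotated, hF.isHermitian_groupProj.eq]
    · rw [rotated_mul, hF.groupProj_mul_self]
  have hstate : IsState ρ := by
    refine ⟨hQ.smul hdpos, ?_⟩
    rw [hρ, Matrix.trace_smul, trace_rotated, hF.trace_groupProj, smul_eq_mul, inv_mul_cancel₀ hd0]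
  have henergy : energy (rotated (stabilizerHamiltonian S)) ρ = 0 := by
    rw [energy_rotated_stabilizerHamiltonian, Finset.sum_eq_zero, mul_zero]
    intro P hP
    have hPs := PauliElement.toOp_eq_pauliString (htype P hP)
    have hPF : P.toOp ∈ F := by
      have h2 : P.toOp * P.toOp = 1 := by rw [hPs, pauliString_mul_self]
      exact (hmem _).2 ⟨⟨P.toOp, P.toOp, h2, h2⟩, Subgroup.subset_closure ⟨P, hP, rfl⟩, rfl⟩
    rw [energy, Matrix.trace_mul_comm, hρ, Matrix.mul_smul, rotated_mul, PauliElement.proj,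
      Matrix.smul_mul, Matrix.sub_mul, Matrix.one_mul, hF.mul_groupProj hPF, sub_self, smul_zero]
    simp [rotated]
  rw [← henergy]
  refine csInf_le ⟨0, ?_⟩ ⟨ρ, hstate, rfl⟩
  rintro _ ⟨σ, hσ, rfl⟩
  rw [energy_rotated_stabilizerHamiltonian]
  refine mul_nonneg (by positivity) (Finset.sum_nonneg fun P hP => ?_)
  have hPs := PauliElement.toOp_eq_pauliString (htype P hP)
  exact energy_nonneg_of_idempotent (isHermitian_rotated_proj hPs) (rotated_proj_mul_self hPs) hσ.1

end GroundEnergy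

/-! ### Locality -/

section Locality

variable {n : ℕ}

lemma ActsOn.one (A : Finset (Fin n)) : ActsOn A (1 : Op n) := by
  rw [← tensor_one]
  exact actsOn_tensor A _ fun _ _ => rfl

lemma ActsOn.sub {A : Finset (Fin n)} {M K : Op n} (hM : ActsOn A M) (hK : ActsOn A K) :
    ActsOn A (M - K) := by
  obtain ⟨h, hh⟩ := hM
  obtain ⟨k, hk⟩ := hK
  refine ⟨h - k, fun x y => ?_⟩
  rw [Matrix.sub_apply, hh, hk]
  split_ifs <;> simp

lemma ActsOn.smul {A : Finset (Fin n)} {M : Op n} (c : ℂ) (hM : ActsOn A M) :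
    ActsOn A (c • M) := by
  obtain ⟨h, hh⟩ := hM
  refine ⟨c • h, fun x y => ?_⟩
  rw [Matrix.smul_apply, hh]
  split_ifs <;> simp

lemma actsOn_rotated_proj {P : PauliElement n} (hP : P.toOp = pauliString P.letter) :
    ActsOn P.support (rotated P.proj) := by
  rw [PauliElement.proj, rotated_smul, rotated_sub, rotated_one, hP, rotated_pauliString]
  refine ((ActsOn.one _).sub (actsOn_tensor _ _ fun i hi => ?_)).smul _
  have : P.letter i = .I := by simpa [PauliElement.support] using hi
  rw [this, rotLetter_I]

lemma norm_toEuclideanCLM_le_one_of_idempotent {K : Op n} (hK : K.IsHermitian) (hK2 : K * K = K) :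
    ‖Matrix.toEuclideanCLM (𝕜 := ℂ) K‖ ≤ 1 := by
  apply IsStarProjection.norm_le
  refine ⟨?_, ?_⟩
  · rw [IsIdempotentElem, ← map_mul, hK2]
  · rw [IsSelfAdjoint, ← map_star, Matrix.star_eq_conjTranspose, hK.eq]

lemma isLocalHamiltonian_rotated {S : Finset (PauliElement n)} (hne : S.Nonempty)
    (hS : ∀ P ∈ S, P.IsXType ∨ P.IsZType) {w : ℕ} (hw : ∀ P ∈ S, P.weight ≤ w) :
    IsLocalHamiltonian w S.card (rotated (stabilizerHamiltonian S)) := by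
  refine ⟨hne.card_pos, fun i => rotated (S.equivFin.symm i : PauliElement n).proj, ?_, fun i => ?_⟩
  · rw [stabilizerHamiltonian, rotated_smul, rotated_sum]
    congr 1
    rw [← Finset.sum_coe_sort]
    exact (Equiv.sum_comp S.equivFin.symm fun P : S => rotated (P : PauliElement n).proj).symm
  · set P := S.equivFin.symm i
    have hPs := PauliElement.toOp_eq_pauliString (hS P P.2)
    have hH := isHermitian_rotated_proj hPs
    exact ⟨hH, norm_toEuclideanCLM_le_one_of_idempotent hH (rotated_proj_mul_self hPs),
      (P : PauliElement n).support, hw P P.2, actsOn_rotated_proj hPs⟩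

lemma isLocalFamily_rotated {N : Set ℕ} {S : ∀ n : ℕ, Finset (PauliElement n)}
    (hS : IsCSSLDPCFamily N S) :
    IsLocalFamily N fun n => rotated (stabilizerHamiltonian (S n)) := by
  obtain ⟨w, hw⟩ := hS.sparse
  refine ⟨w, fun n => (S n).card, ⟨1, ?_⟩, fun n hn =>
    isLocalHamiltonian_rotated (hS.nonempty n hn) (hS.css n hn).2 (hw n hn).1⟩
  simpa using hS.card_theta.1

end Locality

end CSSNLCS

theorem theorem3p1 (N : Set ℕ) (S : ∀ n : ℕ, Finset (CSSNLCS.PauliElement n))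
    (hS : CSSNLCS.IsCSSLDPCFamily N S) (α : ℝ) (hα : 0 < α)
    (hodd : ∀ n ∈ N, α * ((S n).card : ℝ) ≤ (((S n).filter fun P => Odd P.weight).card : ℝ)) :
    CSSNLCS.IsNLCS N (fun n => CSSNLCS.rotated (CSSNLCS.stabilizerHamiltonian (S n))) ∧
    CSSNLCS.IsNLCSWith (α * Real.sin (Real.pi / 8) ^ 2) N
      (fun n => CSSNLCS.rotated (CSSNLCS.stabilizerHamiltonian (S n))) ∧
    ∀ n ∈ N, ∀ ψ : CSSNLCS.Op n, CSSNLCS.IsStabilizerState ψ →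
      α * Real.sin (Real.pi / 8) ^ 2 ≤
        CSSNLCS.energy (CSSNLCS.rotated (CSSNLCS.stabilizerHamiltonian (S n))) ψ := by
  have hbound : ∀ n ∈ N, ∀ ψ : CSSNLCS.Op n, CSSNLCS.IsStabilizerState ψ →
      α * Real.sin (Real.pi / 8) ^ 2 ≤
        CSSNLCS.energy (CSSNLCS.rotated (CSSNLCS.stabilizerHamiltonian (S n))) ψ :=
    fun n hn ψ hψ => CSSNLCS.le_energy_of_isStabilizerState (hS.nonempty n hn) (hS.css n hn).2
      (hodd n hn) hψ
  have hwith : CSSNLCS.IsNLCSWith (α * Real.sin (Real.pi / 8) ^ 2) N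
      (fun n => CSSNLCS.rotated (CSSNLCS.stabilizerHamiltonian (S n))) := by
    refine ⟨CSSNLCS.isLocalFamily_rotated hS, 0, fun n hn _ => ?_⟩
    rintro ⟨ψ, hψ, hlow⟩
    have h1 := hbound n hn ψ hψ
    have h2 := CSSNLCS.groundEnergy_nonpos (hS.css n hn)
    rw [CSSNLCS.IsLowEnergy] at hlow
    linarith
  have hsin : 0 < Real.sin (Real.pi / 8) :=
    Real.sin_pos_of_pos_of_lt_pi (by positivity) (by linarith [Real.pi_pos])
  exact ⟨⟨_, by positivity, hwith⟩, hwith, hbound⟩
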